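/- Lemma 1.8. Let $M$ be a von Neumann algebra on a Hilbert space $H$ (of arbitrary dimension), and let its predual $M_*$ be the Banach space of $\sigma$-weakly continuous linear functionals on $M$, with the norm of the dual $M^*$. A weight on $M$ is an additive, positively homogeneous map $\varphi : M_+ \to [0,\infty]$. It is normal if it is a pointwise sum of a family of positive functionals in $M_*$, semifinite if the left ideal $\mathfrak n_\varphi=\{x\in M:\varphi(x^*x)<\infty\}$ is $\sigma$-weakly dense in $M$, and faithful if it vanishes at no non-zero positive element. The standard space $L^2(M)$ is realized from a normal semifinite faithful weight $\varphi$ as its GNS Hilbert space, the completion of $\{x\varphi^{1/2} : x\in\mathfrak n_\varphi\}$ with respect to the inner product $(x\varphi^{1/2}\mid y\varphi^{1/2})=\varphi(x^*y)$. Such weights exist on $M$, and for every choice of such a weight $\varphi$ the following conditions are equivalent: 1. $M$ has separable predual, that is, $M_*$ is norm separable. 2. $M$ has a faithful normal representation on a separable Hilbert space, that is, there are a separable Hilbert space $K$ and an injective unital $*$-homomorphism $\pi : M\to B(K)$ which is continuous for the $\sigma$-weak topologies. 3. The standard space $L^2(M)$, realized from $\varphi$, is separable. -/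

import Mathlib

open scoped Topology NNReal ENNReal ComplexOrder InnerProductSpace

universe u v

noncomputable section

namespace VonNeumannAlgebra

/-- The σ-weak (ultraweak) topology on `B(H)`: the coarsest topology that makes
`x ↦ ∑ₙ ⟪ξₙ, x ηₙ⟫` continuous for all square-summable sequences `ξ`, `η` of vectors.
This is the weak* topology of `B(H)`. -/
@[reducible]
def sigmaWeakOp (H : Type u) [NormedAddCommGroup H] [InnerProductSpace ℂ H] :
    TopologicalSpace (H →L[ℂ] H) :=
  TopologicalSpace.induced
    (fun (x : H →L[ℂ] H) (p : lp (fun _ : ℕ => H) 2 × lp (fun _ : ℕ => H) 2) =>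
      ∑' n, ⟪p.1 n, x (p.2 n)⟫_ℂ)
    inferInstance

variable {H : Type u} [NormedAddCommGroup H] [InnerProductSpace ℂ H] [CompleteSpace H]

/-- The type of elements of a von Neumann algebra, with its structure of a normed star algebra. -/
abbrev Elt (M : VonNeumannAlgebra H) : Type u := M.toStarSubalgebra

/-- The σ-weak topology on a von Neumann algebra. -/
@[reducible]
def sigmaWeak (M : VonNeumannAlgebra H) : TopologicalSpace M.Elt :=
  TopologicalSpace.induced Subtype.val (sigmaWeakOp H)

/-- The predual `M_*`: the σ-weakly continuous functionals on `M`,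
with the norm of the dual Banach space of `M`. -/
def predual (M : VonNeumannAlgebra H) : Submodule ℂ (StrongDual ℂ M.Elt) where
  carrier := {f | Continuous[M.sigmaWeak, inferInstance] f}
  zero_mem' := by
    let _ := M.sigmaWeak
    exact continuous_const (y := (0 : ℂ))
  add_mem' {f g} hf hg := by
    let _ := M.sigmaWeak
    exact Continuous.add (f := fun x => f x) (g := fun x => g x) hf hg
  smul_mem' c f hf := by
    let _ := M.sigmaWeak
    exact Continuous.const_smul (g := fun x => f x) hf c

/-- A representation `π` of `M` on a Hilbert space `K` is normal if it is continuous for the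
weak* (that is, σ-weak) topologies. -/
def IsNormalRep (M : VonNeumannAlgebra H) {K : Type v} [NormedAddCommGroup K]
    [InnerProductSpace ℂ K] [CompleteSpace K] (π : M.Elt →⋆ₐ[ℂ] (K →L[ℂ] K)) : Prop :=
  Continuous[M.sigmaWeak, sigmaWeakOp K] π

/-- The cone `M₊` of positive elements of `M`. -/
def posCone (M : VonNeumannAlgebra H) : Submodule ℝ≥0 (H →L[ℂ] H) where
  carrier := {x | x ∈ M ∧ x.IsPositive}
  zero_mem' := ⟨zero_mem M, ContinuousLinearMap.isPositive_zero⟩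
  add_mem' hx hy := ⟨add_mem hx.1 hy.1, hx.2.add hy.2⟩
  smul_mem' c x hx := by
    have h : c • x = ((c : ℝ) : ℂ) • x := by
      ext v; simp [NNReal.smul_def]
    rw [h]
    exact ⟨M.toStarSubalgebra.smul_mem hx.1 _, hx.2.smul_of_nonneg (by simp)⟩

instance (M : VonNeumannAlgebra H) : Module ℝ≥0 M.posCone := M.posCone.module

instance (M : VonNeumannAlgebra H) : SMul ℝ≥0 M.posCone := M.posCone.smul

/-- `x* x` as a positive element of `M`. -/
def absSq (M : VonNeumannAlgebra H) (x : M.Elt) : M.posCone :=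
  ⟨star (x : H →L[ℂ] H) * (x : H →L[ℂ] H), mul_mem (star_mem x.2) x.2,
    ContinuousLinearMap.isPositive_adjoint_comp_self (x : H →L[ℂ] H)⟩

/-- A weight on `M`: an additive, positively homogeneous map `M₊ → [0, ∞]`, `0 · ∞ = 0`. -/
abbrev Weight (M : VonNeumannAlgebra H) : Type u := M.posCone →ₗ[ℝ≥0] ℝ≥0∞

namespace Weight

variable {M : VonNeumannAlgebra H} (φ : M.Weight)

/-- The value `φ(x* x)`. -/
def sq (x : M.Elt) : ℝ≥0∞ := φ (M.absSq x)

theorem sq_zero : φ.sq 0 = 0 := by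
  have : M.absSq 0 = 0 := Subtype.ext (by simp [absSq])
  rw [sq, this, map_zero]

theorem sq_smul (c : ℂ) (x : M.Elt) : φ.sq (c • x) = (‖c‖₊ ^ 2 : ℝ≥0) * φ.sq x := by
  have : M.absSq (c • x) = (‖c‖₊ ^ 2 : ℝ≥0) • M.absSq x := by
    apply Subtype.ext
    have h : c * (starRingEnd ℂ) c = ((‖c‖ ^ 2 : ℝ) : ℂ) := by
      rw [Complex.mul_conj, Complex.normSq_eq_norm_sq]
    rw [SetLike.val_smul]
    ext v
    simp only [absSq, SetLike.val_smul, star_smul, Complex.star_def, smul_mul_assoc,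
      mul_smul_comm, smul_smul, h, NNReal.smul_def, smul_apply,
      NNReal.coe_pow, coe_nnnorm]
    rfl
  rw [sq, this, map_smul, sq, ENNReal.smul_def, smul_eq_mul]

theorem sq_parallelogram (x y : M.Elt) :
    φ.sq (x + y) + φ.sq (x - y) = 2 * (φ.sq x + φ.sq y) := by
  have : M.absSq (x + y) + M.absSq (x - y)
      = (M.absSq x + M.absSq y) + (M.absSq x + M.absSq y) := by
    apply Subtype.ext
    simp only [absSq, AddMemClass.coe_add, AddSubgroupClass.coe_sub, star_add,
      star_sub]
    noncomm_ring
  have h := congrArg φ this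
  simp only [map_add] at h
  rw [sq, sq, h, two_mul]
  rfl

/-- The left ideal `n_φ = {x ∈ M : φ(x* x) < ∞}`. -/
def squareFinite : Submodule ℂ M.Elt where
  carrier := {x | φ.sq x < ∞}
  zero_mem' := by simp [sq_zero]
  add_mem' {x y} hx hy := by
    have h := φ.sq_parallelogram x y
    have h2 : 2 * (φ.sq x + φ.sq y) < ∞ :=
      ENNReal.mul_lt_top (by simp) (ENNReal.add_lt_top.2 ⟨hx, hy⟩)
    exact lt_of_le_of_lt le_self_add (h ▸ h2)
  smul_mem' c x hx := by
    simp only [Set.mem_ofPred_eq, sq_smul] at hx ⊢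
    exact ENNReal.mul_lt_top (by simp) hx

/-- `φ` is faithful: it vanishes at no nonzero positive element. -/
def IsFaithful : Prop := ∀ a : M.posCone, φ a = 0 → a = 0

/-- `φ` is semifinite: `n_φ` is σ-weakly dense in `M`. -/
def IsSemifinite : Prop := @Dense _ M.sigmaWeak (φ.squareFinite : Set M.Elt)

/-- `φ` is normal: it is a pointwise sum of a family of positive functionals in `M_*`. -/
def IsNormal : Prop :=
  ∃ (ι : Type u) (ω : ι → StrongDual ℂ M.Elt),
    (∀ i, ω i ∈ M.predual) ∧ (∀ i x, 0 ≤ ω i (star x * x)) ∧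
    ∀ a : M.posCone, φ a = ∑' i, ENNReal.ofReal (ω i ⟨a, a.2.1⟩).re

/-- Normal semifinite faithful weights. -/
structure IsNSF : Prop where
  normal : φ.IsNormal
  semifinite : φ.IsSemifinite
  faithful : φ.IsFaithful

/-- `n_φ`, regarded as the space of the vectors `x φ^{1/2}`, with the inner product `φ(x* y)`. -/
def PreL2 : Type u := φ.squareFinite

instance : AddCommGroup φ.PreL2 := inferInstanceAs (AddCommGroup φ.squareFinite)
instance : Module ℂ φ.PreL2 := inferInstanceAs (Module ℂ φ.squareFinite)

namespace PreL2

variable {φ}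

/-- The element `x` of `M` under the vector `x φ^{1/2}`. -/
def elt : φ.PreL2 →ₗ[ℂ] M.Elt := φ.squareFinite.subtype

/-- The finite number `φ(x* x)`. -/
def q (x : φ.PreL2) : ℝ := (φ.sq (elt x)).toReal

/-- The real part of `φ(x* y)`, by polarization. -/
def B (x y : φ.PreL2) : ℝ := (q (x + y) - q (x - y)) / 4

theorem absSq_eq (x : φ.PreL2) : φ (M.absSq (elt x)) = ENNReal.ofReal (q x) :=
  (ENNReal.ofReal_toReal (ne_of_lt (show φ.sq (elt x) < ∞ from x.2))).symm

theorem q_nonneg (x : φ.PreL2) : 0 ≤ q x := ENNReal.toReal_nonneg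

theorem q_smul (c : ℂ) (x : φ.PreL2) : q (c • x) = ‖c‖ ^ 2 * q x := by
  simp [q, sq_smul]

theorem q_neg (x : φ.PreL2) : q (-x) = q x := by
  have := q_smul (-1) x
  simpa using this

theorem B_comm (x y : φ.PreL2) : B x y = B y x := by
  rw [B, B, add_comm, ← neg_sub y x, q_neg]

theorem B_neg_left (x y : φ.PreL2) : B (-x) y = -B x y := by
  have h1 : -x + y = -(x - y) := by abel
  have h2 : -x - y = -(x + y) := by abel
  rw [B, B, h1, h2, q_neg, q_neg]
  ring

theorem B_self (x : φ.PreL2) : B x x = q x := by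
  have h := q_smul 2 x
  have h0 : q (0 : φ.PreL2) = 0 := by simpa using q_smul 0 x
  rw [two_smul] at h
  rw [B, h, sub_self, h0]
  norm_num

theorem B_I (x y : φ.PreL2) : B (Complex.I • x) (Complex.I • y) = B x y := by
  rw [B, B, ← smul_add, ← smul_sub, q_smul, q_smul]
  simp

theorem B_add_left (x y z : φ.PreL2) : B (x + y) z = B x z + B y z := by
  have : M.absSq (elt (x + y + z)) + M.absSq (elt (x - z)) + M.absSq (elt (y - z))
      = M.absSq (elt (x + y - z)) + M.absSq (elt (x + z)) + M.absSq (elt (y + z)) := by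
    apply Subtype.ext
    simp only [absSq, AddMemClass.coe_add, AddSubgroupClass.coe_sub, star_add,
      star_sub, map_add, map_sub]
    noncomm_ring
  have h := congrArg φ this
  simp only [map_add φ, absSq_eq] at h
  rw [← ENNReal.ofReal_add, ← ENNReal.ofReal_add, ← ENNReal.ofReal_add, ← ENNReal.ofReal_add,
    ENNReal.ofReal_eq_ofReal_iff] at h
  · simp only [B]
    linarith
  all_goals
    first
    | exact q_nonneg _
    | exact add_nonneg (q_nonneg _) (q_nonneg _)
    | exact add_nonneg (add_nonneg (q_nonneg _) (q_nonneg _)) (q_nonneg _)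

theorem B_nonneg_smul_left (r : ℝ≥0) (x z : φ.PreL2) :
    B (((r : ℝ) : ℂ) • x) z = r * B x z := by
  have : M.absSq (elt (((r : ℝ) : ℂ) • x + z)) + r • M.absSq (elt (x - z))
      = M.absSq (elt (((r : ℝ) : ℂ) • x - z)) + r • M.absSq (elt (x + z)) := by
    apply Subtype.ext
    have h (a : H →L[ℂ] H) : r • a = ((r : ℝ) : ℂ) • a := by
      ext v; simp [NNReal.smul_def]
    simp only [absSq, AddMemClass.coe_add, AddSubgroupClass.coe_sub, star_add,
      star_sub, map_add, map_sub, map_smul, SetLike.val_smul, star_smul, h,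
      Complex.star_def, Complex.conj_ofReal, add_mul, mul_add, sub_mul, mul_sub, smul_add,
      smul_sub, smul_mul_assoc, mul_smul_comm]
    abel
  have h := congrArg φ this
  simp only [map_add φ, map_smul φ, absSq_eq, ENNReal.smul_def, smul_eq_mul,
    ← ENNReal.ofReal_coe_nnreal] at h
  rw [← ENNReal.ofReal_mul r.coe_nonneg, ← ENNReal.ofReal_mul r.coe_nonneg, ← ENNReal.ofReal_add,
    ← ENNReal.ofReal_add, ENNReal.ofReal_eq_ofReal_iff] at h
  · simp only [B]
    linarith
  all_goals
    first
    | exact q_nonneg _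
    | exact mul_nonneg r.coe_nonneg (q_nonneg _)
    | exact add_nonneg (q_nonneg _) (mul_nonneg r.coe_nonneg (q_nonneg _))

theorem B_real_smul_left (r : ℝ) (x z : φ.PreL2) : B ((r : ℂ) • x) z = r * B x z := by
  rcases le_total 0 r with hr | hr
  · exact B_nonneg_smul_left ⟨r, hr⟩ x z
  · have h := B_nonneg_smul_left ⟨-r, neg_nonneg.2 hr⟩ x z
    have h2 : (((⟨-r, neg_nonneg.2 hr⟩ : ℝ≥0) : ℝ) : ℂ) • x = -((r : ℂ) • x) := by
      simp
    have h3 : B (-((r : ℂ) • x)) z = -r * B x z := by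
      rw [← h2]
      exact h
    rw [B_neg_left] at h3
    linarith

theorem B_I_left (x y : φ.PreL2) : B (Complex.I • x) y = -B x (Complex.I • y) := by
  have h := B_I (Complex.I • x) y
  rw [smul_smul, Complex.I_mul_I, neg_one_smul, B_neg_left] at h
  exact h.symm

theorem B_smul_left (c : ℂ) (x z : φ.PreL2) :
    B (c • x) z = c.re * B x z - c.im * B x (Complex.I • z) := by
  have h : c • x = (c.re : ℂ) • x + (c.im : ℂ) • Complex.I • x := by
    rw [smul_smul, ← add_smul, Complex.re_add_im]
  rw [h, B_add_left, B_real_smul_left, B_real_smul_left, B_I_left]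
  ring

/-- The positive semidefinite form `⟪x, y⟫ = φ(x* y)` on `n_φ`, obtained from
`⟪x, x⟫ = φ(x* x)` by polarization. -/
abbrev core : PreInnerProductSpace.Core ℂ φ.PreL2 where
  inner x y := ⟨B x y, -B x (Complex.I • y)⟩
  conj_inner_symm x y := by
    apply Complex.ext
    · simpa using B_comm y x
    · have := B_I_left x y
      rw [B_comm] at this
      simpa using this
  re_inner_nonneg x := by
    simpa [B_self] using q_nonneg x
  add_left x y z := by
    apply Complex.ext
    · simpa using B_add_left x y z
    · simp [B_add_left]; ring
  smul_left x y c := by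
    apply Complex.ext
    · simp [B_smul_left]
    · have h : B x (Complex.I • Complex.I • y) = -B x y := by
        rw [smul_smul, Complex.I_mul_I, neg_one_smul, B_comm, B_neg_left, B_comm]
      simp [B_smul_left, h]; ring

instance : SeminormedAddCommGroup φ.PreL2 :=
  InnerProductSpace.Core.toSeminormedAddCommGroup (c := core)

instance : InnerProductSpace ℂ φ.PreL2 := InnerProductSpace.ofCore core

theorem inner_self_eq (x : φ.PreL2) : ⟪x, x⟫_ℂ = ((φ.sq (elt x)).toReal : ℂ) := by
  have h : B x (Complex.I • x) = 0 := by
    have h1 := B_I_left x x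
    rw [B_comm] at h1
    linarith
  apply Complex.ext
  · exact B_self x
  · exact (neg_eq_zero.2 h)

end PreL2

/-- The standard Hilbert space `L²(M)`, realized from the weight `φ`: the completion of
`{x φ^{1/2} : x ∈ n_φ}`. -/
abbrev L2 : Type u := UniformSpace.Completion φ.PreL2

end Weight

end VonNeumannAlgebra

end

/-! The engine is the duality between `M` and the norm closure of `M_*`, and it works in two
directions. (Using the closure avoids ever having to know that `M_*` is complete.)

From separability elsewhere to `M_*`: a bounded functional on `M^*` restricts on that closure to
evaluation at some `x ∈ M` (`exists_eval_eq`, by the bicommutant property). By Hahn–Banach, a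
norm-separable subset of the closure that separates the points of `M` therefore spans a dense
subspace (`separableSpace_predual_of_separating`). For 2 → 1 take the coefficients `⟪ξ, π(x) η⟫`;
for 3 → 1 take `x ↦ φ(y* x z)` with `y`, `z` in a countable dense set.

From `M_*` to separability elsewhere: if `M_*` is separable, every subspace `S` of `M` has a
countable subset `D` such that a functional in the closure vanishing on `D` vanishes on `S`
(`exists_countable_of_separable_predual`). For 1 → 2, countably many vectors `Z` separate `M`, and
the closed span of `MZ` is invariant, and separable because `DZ` already spans it densely. For 1 →
3, write `φ = ∑ ω i`: only countably many `ω i` are nonzero, and the maps `z φ^{1/2} ↦ ω i (· z)`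
extend to `L²` and are jointly injective there, so evaluating them on `D` gives countably many
functionals separating `L²`.

Existence of a weight: sum the vector functionals of a maximal family of vectors with pairwise
orthogonal orbits under the commutant. -/

noncomputable section

namespace VonNeumannAlgebra

variable {H : Type u} [NormedAddCommGroup H] [InnerProductSpace ℂ H] [CompleteSpace H]

/-! ### Vector functionals and the predual. -/

/-- The functional `x ↦ ⟪ξ, x η⟫` on `M`. -/
def vecFun (M : VonNeumannAlgebra H) (ξ η : H) : StrongDual ℂ M.Elt :=
  LinearMap.mkContinuous
    { toFun := fun x => ⟪ξ, (x : H →L[ℂ] H) η⟫_ℂ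
      map_add' := fun x y => by simp
      map_smul' := fun c x => by simp } (‖ξ‖ * ‖η‖) fun x => by
    refine (norm_inner_le_norm _ _).trans ?_
    rw [mul_assoc, mul_comm ‖η‖]
    gcongr
    exact (x : H →L[ℂ] H).le_opNorm η

@[simp]
theorem vecFun_apply (M : VonNeumannAlgebra H) (ξ η : H) (x : M.Elt) :
    M.vecFun ξ η x = ⟪ξ, (x : H →L[ℂ] H) η⟫_ℂ := rfl

theorem norm_vecFun_le (M : VonNeumannAlgebra H) (ξ η : H) : ‖M.vecFun ξ η‖ ≤ ‖ξ‖ * ‖η‖ :=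
  LinearMap.mkContinuous_norm_le _ (by positivity) _

theorem summable_norm_mul_norm {K : Type*} [NormedAddCommGroup K] (p q : lp (fun _ : ℕ => K) 2) :
    Summable fun n => ‖p n‖ * ‖q n‖ := by
  have hp := (lp.memℓp p).summable (by norm_num)
  have hq := (lp.memℓp q).summable (by norm_num)
  refine Summable.of_nonneg_of_le (fun n => by positivity) (fun n => ?_) (hp.add hq)
  simp only [ENNReal.toReal_ofNat, Real.rpow_ofNat]
  nlinarith [sq_nonneg (‖p n‖ - ‖q n‖), sq_nonneg (‖p n‖), sq_nonneg (‖q n‖)]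

/-- The functional `x ↦ ∑ₙ ⟪ξₙ, x ηₙ⟫` on `M`, for square-summable sequences `ξ`, `η`. -/
def seqFun (M : VonNeumannAlgebra H) (p : lp (fun _ : ℕ => H) 2 × lp (fun _ : ℕ => H) 2) :
    StrongDual ℂ M.Elt :=
  ∑' n, M.vecFun (p.1 n) (p.2 n)

theorem hasSum_seqFun (M : VonNeumannAlgebra H)
    (p : lp (fun _ : ℕ => H) 2 × lp (fun _ : ℕ => H) 2) :
    HasSum (fun n => M.vecFun (p.1 n) (p.2 n)) (M.seqFun p) :=
  (Summable.of_norm_bounded (summable_norm_mul_norm p.1 p.2)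
    fun n => M.norm_vecFun_le (p.1 n) (p.2 n)).hasSum

theorem seqFun_apply (M : VonNeumannAlgebra H)
    (p : lp (fun _ : ℕ => H) 2 × lp (fun _ : ℕ => H) 2) (x : M.Elt) :
    M.seqFun p x = ∑' n, ⟪p.1 n, (x : H →L[ℂ] H) (p.2 n)⟫_ℂ :=
  (((ContinuousLinearMap.apply ℂ ℂ x).hasSum (M.hasSum_seqFun p)).tsum_eq).symm

/-- Exhibits the σ-weak topology as the initial topology of a family of linear functionals; the
continuous functionals for such a topology are the finite linear combinations of the family, whence
`mem_predual_iff`. -/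
theorem sigmaWeak_eq_iInf (M : VonNeumannAlgebra H) :
    M.sigmaWeak = ⨅ p, TopologicalSpace.induced
      (fun x => ((M.seqFun p : M.Elt →L[ℂ] ℂ) : M.Elt →ₗ[ℂ] ℂ) x) inferInstance := by
  rw [sigmaWeak, sigmaWeakOp, induced_compose, Pi.topologicalSpace, induced_iInf]
  refine iInf_congr fun p => ?_
  rw [induced_compose]
  congr 1
  ext x
  exact (M.seqFun_apply p x).symm

theorem seqFun_mem_predual (M : VonNeumannAlgebra H)
    (p : lp (fun _ : ℕ => H) 2 × lp (fun _ : ℕ => H) 2) : M.seqFun p ∈ M.predual := by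
  change Continuous[M.sigmaWeak, _] _
  rw [sigmaWeak_eq_iInf]
  exact continuous_iInf_dom (i := p) continuous_induced_dom

theorem mem_predual_iff (M : VonNeumannAlgebra H) (f : StrongDual ℂ M.Elt) :
    f ∈ M.predual ↔ f ∈ Submodule.span ℂ (Set.range M.seqFun) := by
  constructor
  · intro h
    change Continuous[M.sigmaWeak, _] _ at h
    rw [sigmaWeak_eq_iInf] at h
    have h2 := (LinearMap.mem_span_iff_continuous
      (f := fun p => ((M.seqFun p : M.Elt →L[ℂ] ℂ) : M.Elt →ₗ[ℂ] ℂ))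
      (f : M.Elt →ₗ[ℂ] ℂ)).2 h
    have h3 : Set.range (fun p => ((M.seqFun p : M.Elt →L[ℂ] ℂ) : M.Elt →ₗ[ℂ] ℂ))
        = (ContinuousLinearMap.coeLM ℂ : StrongDual ℂ M.Elt →ₗ[ℂ] M.Elt →ₗ[ℂ] ℂ) ''
          Set.range M.seqFun := by
      rw [← Set.range_comp]; rfl
    rw [h3, Submodule.span_image] at h2
    obtain ⟨g, hg, hgf⟩ := h2
    have : g = f := by
      ext x
      exact LinearMap.congr_fun hgf x
    exact this ▸ hg
  · intro h
    refine (Submodule.span_le.2 ?_) h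
    rintro _ ⟨p, rfl⟩
    exact M.seqFun_mem_predual p

theorem vecFun_mem_predual (M : VonNeumannAlgebra H) (ξ η : H) : M.vecFun ξ η ∈ M.predual := by
  have : M.vecFun ξ η = M.seqFun (lp.single 2 0 ξ, lp.single 2 0 η) := by
    refine ((M.hasSum_seqFun _).unique ?_).symm
    have := hasSum_single (f := fun n => M.vecFun ((lp.single (E := fun _ : ℕ => H) 2 0 ξ) n)
      ((lp.single (E := fun _ : ℕ => H) 2 0 η) n)) 0 (fun n hn => by
        ext x
        simp [lp.single_apply, hn])
    simpa [lp.single_apply] using this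
  rw [this]
  exact M.seqFun_mem_predual _

/-- A submodule that is closed and contains the vector functionals contains the closure of the
predual. -/
theorem closure_predual_le (M : VonNeumannAlgebra H) (S : Submodule ℂ (StrongDual ℂ M.Elt))
    (hS : IsClosed (S : Set (StrongDual ℂ M.Elt))) (h : ∀ ξ η, M.vecFun ξ η ∈ S) :
    M.predual.topologicalClosure ≤ S := by
  refine Submodule.topologicalClosure_minimal _ (fun f hf => ?_) hS
  rw [mem_predual_iff] at hf
  refine (Submodule.span_le.2 ?_) hf
  rintro _ ⟨p, rfl⟩
  exact hS.mem_of_tendsto (M.hasSum_seqFun p)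
    (Filter.Eventually.of_forall fun s => S.sum_mem fun i _ => h _ _)

/-! ### Duality between `M` and the closure of the predual. -/

theorem inner_eq_of_mem_commutant {M : VonNeumannAlgebra H} {u : H →L[ℂ] H}
    (hu : u ∈ M.commutant) (ξ η : H) : M.vecFun (star u ξ) η = M.vecFun ξ (u η) := by
  ext x
  rw [vecFun_apply, vecFun_apply, ContinuousLinearMap.star_eq_adjoint,
    ContinuousLinearMap.adjoint_inner_left]
  congr 1
  exact (DFunLike.congr_fun (mem_commutant_iff.1 hu x x.2) η).symm

theorem mem_of_forall_commutant (M : VonNeumannAlgebra H) {x : H →L[ℂ] H}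
    (h : ∀ u ∈ M.commutant, u * x = x * u) : x ∈ M.toStarSubalgebra := by
  have : x ∈ M.commutant.commutant := mem_commutant_iff.2 h
  rwa [commutant_commutant] at this

/-- Every bounded functional on `M^*` agrees on the closure of the predual with the evaluation at
an element of `M`. -/
theorem exists_eval_eq (M : VonNeumannAlgebra H) (F : StrongDual ℂ (StrongDual ℂ M.Elt)) :
    ∃ x : M.Elt, ∀ f ∈ M.predual.topologicalClosure, F f = f x := by
  let B : H →L⋆[ℂ] H →L[ℂ] ℂ := LinearMap.mkContinuous₂
    (LinearMap.mk₂'ₛₗ (starRingEnd ℂ) (RingHom.id ℂ) (fun ξ η => F (M.vecFun ξ η))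
      (fun ξ ξ' η => by
        rw [← map_add]; congr 1; ext x; simp)
      (fun c ξ η => by
        rw [← map_smul]; congr 1; ext x; simp [mul_comm])
      (fun ξ η η' => by
        rw [← map_add]; congr 1; ext x; simp)
      (fun c ξ η => by
        rw [← map_smul]; congr 1; ext x; simp)) ‖F‖ fun ξ η => by
    refine (F.le_opNorm _).trans ?_
    rw [mul_assoc]
    gcongr
    exact M.norm_vecFun_le ξ η
  -- The Riesz operator of the form `B` acts in the left slot of the inner product; its adjoint acts
  -- in the right one.
  let T : H →L[ℂ] H := star (InnerProductSpace.continuousLinearMapOfBilin B)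
  have hT (ξ η : H) : ⟪ξ, T η⟫_ℂ = F (M.vecFun ξ η) := by
    simp only [T, ContinuousLinearMap.star_eq_adjoint]
    rw [ContinuousLinearMap.adjoint_inner_right,
      InnerProductSpace.continuousLinearMapOfBilin_apply]
    rfl
  -- Elements of the commutant can be moved between the two vectors of a vector functional, so `T`
  -- commutes with them and lies in the bicommutant.
  have hTM : T ∈ M.toStarSubalgebra := by
    refine M.mem_of_forall_commutant fun u hu => ?_
    ext η
    refine ext_inner_left ℂ fun ξ => ?_
    rw [mul_apply_eq_comp, mul_apply_eq_comp, hT,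
      ← inner_eq_of_mem_commutant hu, ← hT, ContinuousLinearMap.star_eq_adjoint,
      ContinuousLinearMap.adjoint_inner_left]
  refine ⟨⟨T, hTM⟩, fun f hf => ?_⟩
  let G : StrongDual ℂ (StrongDual ℂ M.Elt) := F - ContinuousLinearMap.apply ℂ ℂ ⟨T, hTM⟩
  have hG : M.predual.topologicalClosure ≤ LinearMap.ker (G : StrongDual ℂ M.Elt →ₗ[ℂ] ℂ) := by
    refine M.closure_predual_le _ (ContinuousLinearMap.isClosed_ker G) fun ξ η => ?_
    rw [LinearMap.mem_ker]
    simp [G, hT]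
  exact sub_eq_zero.1 (LinearMap.mem_ker.1 (hG hf))

/-- Hahn–Banach in the quotient by `S`, a normed space because `S` is closed. -/
theorem exists_dual_eq_zero_of_notMem {E : Type*} [NormedAddCommGroup E] [NormedSpace ℂ E]
    (S : Submodule ℂ E) (hS : IsClosed (S : Set E)) {v : E} (hv : v ∉ S) :
    ∃ F : StrongDual ℂ E, F v ≠ 0 ∧ ∀ w ∈ S, F w = 0 := by
  have hne : S.mkQ v ≠ 0 := by simpa using hv
  obtain ⟨G, hG⟩ := SeparatingDual.exists_ne_zero (R := ℂ) hne
  refine ⟨G.comp S.mkQL, hG, fun w hw => ?_⟩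
  have : S.mkQ w = 0 := by simpa using hw
  change G (S.mkQ w) = 0
  rw [this, map_zero]

/-- The predual is separable as soon as a norm-separable subset of its closure separates the
points of `M`. -/
theorem separableSpace_predual_of_separating (M : VonNeumannAlgebra H)
    (T : Set (StrongDual ℂ M.Elt)) (hT : TopologicalSpace.IsSeparable T)
    (hTM : T ⊆ M.predual.topologicalClosure)
    (hsep : ∀ x : M.Elt, (∀ f ∈ T, f x = 0) → x = 0) :
    TopologicalSpace.SeparableSpace M.predual := by
  have hs : TopologicalSpace.IsSeparable (M.predual : Set (StrongDual ℂ M.Elt)) := by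
    refine (hT.span (R := ℂ)).closure.mono fun f hf => ?_
    change f ∈ (Submodule.span ℂ T).topologicalClosure
    by_contra hfT
    obtain ⟨F, hF, hF0⟩ := exists_dual_eq_zero_of_notMem _
      (Submodule.isClosed_topologicalClosure _) hfT
    obtain ⟨x, hx⟩ := M.exists_eval_eq F
    have hx0 : x = 0 := hsep x fun g hg => by
      rw [← hx g (hTM hg)]
      exact hF0 g (Submodule.le_topologicalClosure _ (Submodule.subset_span hg))
    apply hF
    rw [hx f (Submodule.le_topologicalClosure _ hf), hx0, map_zero]
  exact hs.separableSpace

/-! ### Positive elements and positive functionals. -/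

instance isClosed_carrier (M : VonNeumannAlgebra H) :
    IsClosed (M.toStarSubalgebra : Set (H →L[ℂ] H)) := by
  rw [coe_toStarSubalgebra, ← centralizer_centralizer]
  exact Set.isClosed_centralizer _

instance cstarAlgebra (M : VonNeumannAlgebra H) : CStarAlgebra M.Elt :=
  inferInstanceAs (CStarAlgebra M.toStarSubalgebra)

/-- A positive element of `M` has the form `b* b` with `b` in `M`. -/
theorem exists_star_mul_self_eq {M : VonNeumannAlgebra H} {a : H →L[ℂ] H} (ha : a ∈ M)
    (hpos : a.IsPositive) : ∃ b : M.Elt, star (b : H →L[ℂ] H) * b = a := by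
  have h0 : 0 ≤ a := (ContinuousLinearMap.nonneg_iff_isPositive a).2 hpos
  have hs : star (CFC.sqrt a) = CFC.sqrt a := (IsSelfAdjoint.of_nonneg (CFC.sqrt_nonneg a)).star_eq
  refine ⟨⟨CFC.sqrt a, M.mem_of_forall_commutant fun u hu => ?_⟩, ?_⟩
  -- The square root commutes with whatever commutes with `a`, in particular with the commutant.
  · have hc : Commute a u := mem_commutant_iff.1 hu a ha
    exact (hc.cfcₙ_nnreal _).eq.symm
  · change star (CFC.sqrt a) * CFC.sqrt a = a
    rw [hs]
    exact CFC.sqrt_mul_sqrt_self a h0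

section PositiveFunctional

variable {M : VonNeumannAlgebra H} {ω : StrongDual ℂ M.Elt}

/-- Polarization: `ω` is real at the squares of `x + y` and `x + i y`, which fixes the imaginary and
the real parts respectively. -/
theorem conj_apply_star_mul (hω : ∀ x, 0 ≤ ω (star x * x)) (x y : M.Elt) :
    starRingEnd ℂ (ω (star y * x)) = ω (star x * y) := by
  have h1 := (Complex.le_def.1 (hω (x + y))).2
  have h2 := (Complex.le_def.1 (hω (x + Complex.I • y))).2
  have hx := (Complex.le_def.1 (hω x)).2
  have hy := (Complex.le_def.1 (hω y)).2
  simp only [star_add, star_smul, add_mul, mul_add, smul_mul_assoc, mul_smul_comm, map_add,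
    map_smul, smul_eq_mul, Complex.add_im, Complex.mul_im, Complex.zero_im, Complex.star_def,
    Complex.conj_I, Complex.neg_im, Complex.neg_re, Complex.I_re, Complex.I_im, Complex.mul_re] at *
  apply Complex.ext
  · rw [Complex.conj_re]; linarith
  · rw [Complex.conj_im]; linarith

/-- The seminorm `ω(x* x)^{1/2}` of a positive functional `ω`. -/
def gnsNorm (ω : StrongDual ℂ M.Elt) (x : M.Elt) : ℝ := √(ω (star x * x)).re

theorem gnsNorm_nonneg (ω : StrongDual ℂ M.Elt) (x : M.Elt) : 0 ≤ gnsNorm ω x :=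
  Real.sqrt_nonneg _

theorem gnsNorm_sq (hω : ∀ x, 0 ≤ ω (star x * x)) (x : M.Elt) :
    gnsNorm ω x ^ 2 = (ω (star x * x)).re :=
  Real.sq_sqrt (Complex.le_def.1 (hω x)).1

theorem norm_apply_star_mul_le (hω : ∀ x, 0 ≤ ω (star x * x)) (x y : M.Elt) :
    ‖ω (star x * y)‖ ≤ gnsNorm ω x * gnsNorm ω y := by
  let c : PreInnerProductSpace.Core ℂ M.Elt :=
    { inner := fun a b => ω (star a * b)
      conj_inner_symm := fun a b => conj_apply_star_mul hω a b
      re_inner_nonneg := fun a => (Complex.le_def.1 (hω a)).1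
      add_left := fun a b d => by simp [add_mul]
      smul_left := fun a b r => by simp }
  have h : ‖ω (star x * y)‖ * ‖ω (star y * x)‖ ≤ (ω (star x * x)).re * (ω (star y * y)).re :=
    @InnerProductSpace.Core.inner_mul_inner_self_le ℂ M.Elt _ _ _ c x y
  rw [← conj_apply_star_mul hω y x, Complex.norm_conj, ← gnsNorm_sq hω, ← gnsNorm_sq hω] at h
  have := gnsNorm_nonneg ω x
  have := gnsNorm_nonneg ω y
  refine abs_le_of_sq_le_sq' ?_ (by positivity) |>.2
  nlinarith

theorem exists_norm_sq_smul_sub (x : M.Elt) :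
    ∃ b : M.Elt, star b * b = ((‖x‖ ^ 2 : ℝ) : ℂ) • (1 : M.Elt) - star x * x := by
  have hpos : (((‖x‖ ^ 2 : ℝ) : ℂ) • (1 : H →L[ℂ] H)
      - star (x : H →L[ℂ] H) * (x : H →L[ℂ] H)).IsPositive := by
    rw [← ContinuousLinearMap.nonneg_iff_isPositive, sub_nonneg]
    have h := CStarAlgebra.star_mul_le_algebraMap_norm_sq (a := (x : H →L[ℂ] H))
    refine h.trans_eq ?_
    rw [Algebra.algebraMap_eq_smul_one, ← Complex.coe_smul]
    rfl
  obtain ⟨b, hb⟩ := exists_star_mul_self_eq (M := M)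
    (sub_mem (M.toStarSubalgebra.smul_mem (one_mem M) _) (mul_mem (star_mem x.2) x.2)) hpos
  exact ⟨b, Subtype.ext hb⟩

/-- With `b* b = ‖x‖² - x* x`, this is positivity of `ω` at `(b y)* (b y)`. -/
theorem gnsNorm_mul_le (hω : ∀ x, 0 ≤ ω (star x * x)) (x y : M.Elt) :
    gnsNorm ω (x * y) ≤ ‖x‖ * gnsNorm ω y := by
  obtain ⟨b, hb⟩ := exists_norm_sq_smul_sub x
  have h := (Complex.le_def.1 (hω (b * y))).1
  have h2 : star (b * y) * (b * y)
      = ((‖x‖ ^ 2 : ℝ) : ℂ) • (star y * y) - star (x * y) * (x * y) := by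
    calc star (b * y) * (b * y) = star y * (star b * b) * y := by rw [star_mul]; noncomm_ring
      _ = _ := by
        rw [hb, star_mul, mul_sub, sub_mul, mul_smul_comm, smul_mul_assoc, mul_one]
        simp only [mul_assoc]
  rw [h2, map_sub, map_smul, smul_eq_mul, Complex.sub_re, Complex.re_ofReal_mul,
    ← gnsNorm_sq hω, ← gnsNorm_sq hω, Complex.zero_re] at h
  have := gnsNorm_nonneg ω y
  refine abs_le_of_sq_le_sq' ?_ (by positivity) |>.2
  nlinarith

end PositiveFunctional

/-! ### Two-sided translates of functionals. -/

/-- The operator `ω ↦ ω(a · b)` on `M^*`. -/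
def sandwich (M : VonNeumannAlgebra H) (a b : M.Elt) :
    StrongDual ℂ M.Elt →L[ℂ] StrongDual ℂ M.Elt :=
  (ContinuousLinearMap.compL ℂ M.Elt M.Elt ℂ).flip
    ((ContinuousLinearMap.mul ℂ M.Elt a).comp ((ContinuousLinearMap.mul ℂ M.Elt).flip b))

@[simp]
theorem sandwich_apply (M : VonNeumannAlgebra H) (a b : M.Elt) (ω : StrongDual ℂ M.Elt)
    (x : M.Elt) : M.sandwich a b ω x = ω (a * (x * b)) := rfl

/-- A translate of a vector functional is again a vector functional, and translation is norm
continuous. -/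
theorem sandwich_mem (M : VonNeumannAlgebra H) (a b : M.Elt) {ω : StrongDual ℂ M.Elt}
    (hω : ω ∈ M.predual.topologicalClosure) :
    M.sandwich a b ω ∈ M.predual.topologicalClosure := by
  refine M.closure_predual_le (M.predual.topologicalClosure.comap
    (M.sandwich a b : StrongDual ℂ M.Elt →ₗ[ℂ] StrongDual ℂ M.Elt))
    ((Submodule.isClosed_topologicalClosure _).preimage (M.sandwich a b).continuous)
    (fun ξ η => Submodule.le_topologicalClosure _ ?_) hω
  have : M.sandwich a b (M.vecFun ξ η)
      = M.vecFun (star (a : H →L[ℂ] H) ξ) ((b : H →L[ℂ] H) η) := by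
    ext x
    simp [ContinuousLinearMap.star_eq_adjoint, ContinuousLinearMap.adjoint_inner_left]
  change M.sandwich a b (M.vecFun ξ η) ∈ _
  rw [this]
  exact M.vecFun_mem_predual _ _

theorem norm_sandwich_le {M : VonNeumannAlgebra H} {ω : StrongDual ℂ M.Elt}
    (hω : ∀ x, 0 ≤ ω (star x * x)) (y z : M.Elt) :
    ‖M.sandwich (star y) z ω‖ ≤ gnsNorm ω y * gnsNorm ω z := by
  refine ContinuousLinearMap.opNorm_le_bound _
    (mul_nonneg (gnsNorm_nonneg _ _) (gnsNorm_nonneg _ _)) fun x => ?_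
  rw [sandwich_apply]
  refine (norm_apply_star_mul_le hω y (x * z)).trans ?_
  rw [mul_assoc, mul_comm _ ‖x‖]
  exact mul_le_mul_of_nonneg_left (gnsNorm_mul_le hω x z) (gnsNorm_nonneg _ _)

/-! ### From a separable representation to a separable predual. -/

theorem continuous_sigmaWeakOp_inner {K : Type v} [NormedAddCommGroup K] [InnerProductSpace ℂ K]
    (ξ η : K) : Continuous[sigmaWeakOp K, inferInstance] fun y : K →L[ℂ] K => ⟪ξ, y η⟫_ℂ := by
  let p : lp (fun _ : ℕ => K) 2 × lp (fun _ : ℕ => K) 2 := (lp.single 2 0 ξ, lp.single 2 0 η)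
  have h : (fun y : K →L[ℂ] K => ⟪ξ, y η⟫_ℂ)
      = fun y : K →L[ℂ] K => ∑' n, ⟪p.1 n, y (p.2 n)⟫_ℂ := by
    ext y
    symm
    refine (tsum_eq_single 0 fun n hn => ?_).trans ?_
    · simp [p, lp.single_apply, hn]
    · simp [p, lp.single_apply]
  rw [h]
  exact @Continuous.comp _ _ _ (sigmaWeakOp K) _ _ _ _ (continuous_apply p)
    continuous_induced_dom

/-- If `M` has an injective normal representation on a separable Hilbert space, then its predual
is separable. -/
theorem separableSpace_predual_of_normalRep (M : VonNeumannAlgebra H) {K : Type v}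
    [NormedAddCommGroup K] [InnerProductSpace ℂ K] [CompleteSpace K]
    [TopologicalSpace.SeparableSpace K] (π : M.Elt →⋆ₐ[ℂ] (K →L[ℂ] K))
    (hinj : Function.Injective π) (hπ : M.IsNormalRep π) :
    TopologicalSpace.SeparableSpace M.predual := by
  have hnorm (x : M.Elt) : ‖π x‖ ≤ ‖x‖ := NonUnitalStarAlgHom.norm_apply_le π x
  let P : M.Elt →L[ℂ] (K →L[ℂ] K) :=
    LinearMap.mkContinuous (π : M.Elt →ₗ[ℂ] (K →L[ℂ] K)) 1 fun x => by
      rw [one_mul]; exact hnorm x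
  let g (p : K × K) : StrongDual ℂ M.Elt :=
    ((innerSL ℂ p.1).comp (ContinuousLinearMap.apply ℂ K p.2)).comp P
  have hg : Continuous g := by
    have h1 : Continuous fun p : K × K =>
        (innerSL ℂ p.1).comp (ContinuousLinearMap.apply ℂ K p.2) :=
      ((innerSL ℂ).continuous.comp continuous_fst).clm_comp
        ((ContinuousLinearMap.apply ℂ K).continuous.comp continuous_snd)
    exact h1.clm_comp continuous_const
  have hgx (p : K × K) (x : M.Elt) : g p x = ⟪p.1, π x p.2⟫_ℂ := rfl
  refine M.separableSpace_predual_of_separating (Set.range g)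
    (TopologicalSpace.isSeparable_range hg) ?_ fun x hx => ?_
  · rintro _ ⟨p, rfl⟩
    refine Submodule.le_topologicalClosure _ ?_
    exact @Continuous.comp _ _ _ M.sigmaWeak (sigmaWeakOp K) _ _ _
      (continuous_sigmaWeakOp_inner p.1 p.2) hπ
  · refine hinj ?_
    rw [map_zero]
    ext η
    refine ext_inner_left ℂ fun ξ => ?_
    rw [← hgx (ξ, η), hx _ ⟨(ξ, η), rfl⟩]
    simp

/-! ### From a separable GNS space to a separable predual. -/

namespace Weight

variable {M : VonNeumannAlgebra H} {φ : M.Weight}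

/-- The weight `φ` is the pointwise sum of the positive functionals `ω i` in `M_*`. -/
structure IsSumOf (φ : M.Weight) {ι : Type u} (ω : ι → StrongDual ℂ M.Elt) : Prop where
  mem_predual : ∀ i, ω i ∈ M.predual
  nonneg : ∀ i x, 0 ≤ ω i (star x * x)
  apply_eq : ∀ a : M.posCone, φ a = ∑' i, ENNReal.ofReal (ω i ⟨a, a.2.1⟩).re

theorem ext_of_squareFinite (hφ : φ.IsSemifinite) {f : StrongDual ℂ M.Elt} (hf : f ∈ M.predual)
    (h : ∀ x ∈ φ.squareFinite, f x = 0) : f = 0 := by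
  have := @Continuous.ext_on _ _ inferInstance M.sigmaWeak _ _ hφ f (fun _ => (0 : ℂ)) hf
    (@continuous_const _ _ M.sigmaWeak _ _) h
  ext x
  exact congrFun this x

/-- The functionals `z ↦ ⟪ξ, x z η⟫` are σ-weakly continuous and vanish on the dense set `n_φ`,
hence at `z = 1`. -/
theorem eq_zero_of_mul_squareFinite (hφ : φ.IsSemifinite) {x : M.Elt}
    (h : ∀ z ∈ φ.squareFinite, x * z = 0) : x = 0 := by
  have h1 (ξ η : H) : M.vecFun (star (x : H →L[ℂ] H) ξ) η = 0 := by
    refine ext_of_squareFinite hφ (M.vecFun_mem_predual _ _) fun z hz => ?_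
    rw [vecFun_apply, ContinuousLinearMap.star_eq_adjoint, ContinuousLinearMap.adjoint_inner_left]
    have h2 := congrArg (fun a : M.Elt => (a : H →L[ℂ] H) η) (h z hz)
    have h3 : (x : H →L[ℂ] H) ((z : H →L[ℂ] H) η) = 0 := by simpa using h2
    rw [h3, inner_zero_right]
  apply Subtype.ext
  ext η
  refine ext_inner_left ℂ fun ξ => ?_
  have h2 := DFunLike.congr_fun (h1 ξ η) 1
  rw [vecFun_apply, ContinuousLinearMap.star_eq_adjoint,
    ContinuousLinearMap.adjoint_inner_left] at h2
  simpa using h2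

namespace PreL2

theorem norm_sq_eq (x : φ.PreL2) : ‖x‖ ^ 2 = q x := by
  have h := inner_self_eq x
  rw [inner_self_eq_norm_sq_to_K] at h
  exact Complex.ofReal_injective (by simpa [q] using h)

end PreL2

namespace IsSumOf

open PreL2

variable {ι : Type u} {ω : ι → StrongDual ℂ M.Elt} (hω : φ.IsSumOf ω)

include hω

theorem sq_eq (x : M.Elt) : φ.sq x = ∑' i, ENNReal.ofReal (gnsNorm (ω i) x ^ 2) := by
  rw [sq, hω.apply_eq]
  refine tsum_congr fun i => ?_
  rw [gnsNorm_sq (hω.nonneg i)]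
  rfl

theorem hasSum_gnsNorm_sq (x : φ.PreL2) :
    HasSum (fun i => gnsNorm (ω i) (elt x) ^ 2) (‖x‖ ^ 2) := by
  have hfin : ∑' i, ENNReal.ofReal (gnsNorm (ω i) (elt x) ^ 2) ≠ ∞ := by
    rw [← hω.sq_eq]
    exact ne_of_lt x.2
  have h1 := ENNReal.summable_toReal hfin
  have h2 := ENNReal.tsum_toReal_eq (f := fun i => ENNReal.ofReal (gnsNorm (ω i) (elt x) ^ 2))
    fun i => ENNReal.ofReal_ne_top
  simp only [ENNReal.toReal_ofReal (sq_nonneg _)] at h1 h2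
  rw [norm_sq_eq, q, hω.sq_eq, h2]
  exact h1.hasSum

theorem gnsNorm_le (i : ι) (x : φ.PreL2) : gnsNorm (ω i) (elt x) ≤ ‖x‖ := by
  refine abs_le_of_sq_le_sq' ?_ (norm_nonneg _) |>.2
  exact le_hasSum (hω.hasSum_gnsNorm_sq x) i fun j _ => sq_nonneg _

/-- Polarization of `hasSum_gnsNorm_sq`; hermitian symmetry of each `ω i` merges the two cross
terms. -/
theorem hasSum_B (x y : φ.PreL2) :
    HasSum (fun i => (ω i (star (elt x) * elt y)).re) (B x y) := by
  have h := ((hω.hasSum_gnsNorm_sq (x + y)).sub (hω.hasSum_gnsNorm_sq (x - y))).div_const 4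
  rw [norm_sq_eq, norm_sq_eq] at h
  refine h.congr_fun fun i => ?_
  rw [gnsNorm_sq (hω.nonneg i), gnsNorm_sq (hω.nonneg i)]
  have hc := congrArg Complex.re (conj_apply_star_mul (hω.nonneg i) (elt x) (elt y))
  rw [Complex.conj_re] at hc
  simp only [map_add, map_sub, star_add, star_sub, add_mul, mul_add, sub_mul, mul_sub,
    Complex.add_re, Complex.sub_re]
  linarith

theorem hasSum_inner (x y : φ.PreL2) :
    HasSum (fun i => ω i (star (elt x) * elt y)) ⟪x, y⟫_ℂ := by
  rw [Complex.hasSum_iff]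
  refine ⟨hω.hasSum_B x y, ?_⟩
  refine (hω.hasSum_B x (Complex.I • y)).neg.congr_fun fun i => ?_
  simp

theorem mul_mem_squareFinite (x : M.Elt) {z : M.Elt} (hz : z ∈ φ.squareFinite) :
    x * z ∈ φ.squareFinite := by
  change φ.sq (x * z) < ∞
  rw [hω.sq_eq]
  have hz' : φ.sq z < ∞ := hz
  rw [hω.sq_eq] at hz'
  refine lt_of_le_of_lt ?_ (ENNReal.mul_lt_top (ENNReal.ofReal_lt_top (r := ‖x‖ ^ 2)) hz')
  rw [← ENNReal.tsum_mul_left]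
  refine ENNReal.tsum_le_tsum fun i => ?_
  rw [← ENNReal.ofReal_mul (by positivity), ← mul_pow]
  have := gnsNorm_nonneg (ω i) (x * z)
  exact ENNReal.ofReal_le_ofReal (by gcongr; exact gnsNorm_mul_le (hω.nonneg i) x z)

/-- The left multiplication by `x` on the vectors `z φ^{1/2}`. -/
def lmul (x : M.Elt) : φ.PreL2 →L[ℂ] φ.PreL2 :=
  LinearMap.mkContinuous
    { toFun := fun z => ⟨x * elt z, hω.mul_mem_squareFinite x z.2⟩
      map_add' := fun y z => Subtype.ext (by
        change x * elt (y + z) = x * elt y + x * elt z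
        rw [map_add, mul_add])
      map_smul' := fun c z => Subtype.ext (by
        change x * elt (c • z) = c • (x * elt z)
        rw [map_smul, mul_smul_comm]) } ‖x‖ fun z => by
    refine abs_le_of_sq_le_sq' ?_ (by positivity) |>.2
    rw [mul_pow]
    refine hasSum_le (fun i => ?_) (hω.hasSum_gnsNorm_sq _)
      ((hω.hasSum_gnsNorm_sq z).mul_left (‖x‖ ^ 2))
    rw [← mul_pow]
    have h := gnsNorm_mul_le (hω.nonneg i) x (elt z)
    have h0 := gnsNorm_nonneg (ω i) (x * elt z)
    exact pow_le_pow_left₀ h0 h 2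

/-- The functional `x ↦ φ(y* x z)` is a norm limit of elements of the predual. -/
theorem exists_inner_lmul (y z : φ.PreL2) : ∃ f ∈ M.predual.topologicalClosure,
    ∀ x, f x = ⟪y, hω.lmul x z⟫_ℂ := by
  -- The series `∑ ω i (y* · z)` converges in the norm of `M^*`, not just pointwise; this keeps its
  -- sum in the closure of the predual.
  have hs : Summable fun i => M.sandwich (star (elt y)) (elt z) (ω i) := by
    refine Summable.of_norm_bounded
      ((hω.hasSum_gnsNorm_sq y).summable.add (hω.hasSum_gnsNorm_sq z).summable) fun i => ?_
    refine (norm_sandwich_le (hω.nonneg i) (elt y) (elt z)).trans ?_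
    nlinarith [sq_nonneg (gnsNorm (ω i) (elt y) - gnsNorm (ω i) (elt z)),
      sq_nonneg (gnsNorm (ω i) (elt y)), sq_nonneg (gnsNorm (ω i) (elt z))]
  refine ⟨_, (Submodule.isClosed_topologicalClosure _).mem_of_tendsto hs.hasSum
    (Filter.Eventually.of_forall fun s => Submodule.sum_mem _ fun i _ => M.sandwich_mem _ _
      (Submodule.le_topologicalClosure _ (hω.mem_predual i))), fun x => ?_⟩
  exact ((ContinuousLinearMap.apply ℂ ℂ x).hasSum hs.hasSum).unique
    (hω.hasSum_inner y (hω.lmul x z))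

/-- If the GNS space of a semifinite faithful normal weight is separable, then so is the
predual. -/
theorem separableSpace_predual (hsf : φ.IsSemifinite) (hf : φ.IsFaithful)
    [TopologicalSpace.SeparableSpace φ.PreL2] : TopologicalSpace.SeparableSpace M.predual := by
  choose f hfm hfx using hω.exists_inner_lmul
  obtain ⟨D, hDc, hD⟩ := TopologicalSpace.exists_countable_dense φ.PreL2
  refine M.separableSpace_predual_of_separating (Set.image2 f D D)
    (hDc.image2 hDc f).isSeparable ?_ fun x hx => ?_
  · rintro _ ⟨y, -, z, -, rfl⟩
    exact hfm y z
  have h1 : ∀ y z : φ.PreL2, ⟪y, hω.lmul x z⟫_ℂ = 0 := fun y z => by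
    have h2 : ∀ p : φ.PreL2 × φ.PreL2, ⟪p.1, hω.lmul x p.2⟫_ℂ = 0 := by
      intro p
      refine (hD.prod hD).induction (P := fun p => ⟪p.1, hω.lmul x p.2⟫_ℂ = 0) ?_ ?_ p
      · rintro ⟨y, z⟩ ⟨hy, hz⟩
        rw [← hfx]
        exact hx _ ⟨y, hy, z, hz, rfl⟩
      · exact isClosed_eq (continuous_fst.inner ((hω.lmul x).continuous.comp continuous_snd))
          continuous_const
    exact h2 (y, z)
  refine eq_zero_of_mul_squareFinite hsf fun z hz => ?_
  -- Taking `y = x z` gives `φ((x z)* (x z)) = 0`, so faithfulness yields `x z = 0`.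
  have h3 := h1 (hω.lmul x ⟨z, hz⟩) ⟨z, hz⟩
  rw [inner_self_eq, Complex.ofReal_eq_zero, ENNReal.toReal_eq_zero_iff] at h3
  have h4 : φ.sq (x * z) = 0 := h3.resolve_right (ne_of_lt (hω.lmul x ⟨z, hz⟩).2)
  have h5 := congrArg Subtype.val (hf _ h4)
  have h6 : star ((x * z : M.Elt) : H →L[ℂ] H) * ((x * z : M.Elt) : H →L[ℂ] H) = 0 := h5
  exact Subtype.ext (CStarRing.star_mul_self_eq_zero_iff _ |>.1 h6)

end IsSumOf

end Weight

/-! ### Countable determining sets from a separable predual. -/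

/-- A separable set of functionals can only see countably many points of a bounded set. -/
theorem exists_countable_subset_of_isSeparable {E : Type*} [NormedAddCommGroup E]
    [NormedSpace ℂ E] {X : Set (StrongDual ℂ E)} (hX : TopologicalSpace.IsSeparable X)
    {S : Set E} {R : ℝ} (hS : ∀ s ∈ S, ‖s‖ ≤ R) :
    ∃ D ⊆ S, D.Countable ∧ ∀ f ∈ X, (∀ d ∈ D, f d = 0) → ∀ s ∈ S, f s = 0 := by
  obtain ⟨c, hc, hXc⟩ := hX
  have := hc.to_subtype
  -- Values on the countable family `c` map `S` into a countable power of `ℂ`, which is second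
  -- countable, so the image has a countable dense subset to lift back to `S`.
  let e : E → c → ℂ := fun s g => (g : StrongDual ℂ E) s
  obtain ⟨D₀, hD₀c, hD₀⟩ := TopologicalSpace.exists_countable_dense (e '' S)
  choose r hrS hr using fun v : e '' S => v.2
  refine ⟨r '' D₀, ?_, hD₀c.image r, fun f hf hfD s hs => ?_⟩
  · rintro _ ⟨v, -, rfl⟩
    exact hrS v
  rw [← norm_le_zero_iff]
  refine le_of_forall_pos_le_add fun ε hε => ?_
  have hR : 0 ≤ R := (norm_nonneg s).trans (hS s hs)
  -- The errors add up to `δ R + δ + δ R`: replacing `f` by `g` at `s`, moving from `s` to `r v`,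
  -- and returning to `f` at `r v`.
  set δ := ε / (2 * R + 1) with hδ
  have hδ0 : 0 < δ := by positivity
  obtain ⟨g, hgc, hg⟩ := Metric.mem_closure_iff.1 (hXc hf) δ hδ0
  rw [dist_eq_norm] at hg
  have hfg : ∀ t ∈ S, ‖f t - g t‖ ≤ δ * R := fun t ht =>
    ((f - g).le_opNorm t).trans (by gcongr; exact hS t ht)
  have ho : IsOpen {v : e '' S | ‖g s - (v : c → ℂ) ⟨g, hgc⟩‖ < δ} :=
    isOpen_lt (continuous_const.sub
      ((continuous_apply (⟨g, hgc⟩ : c)).comp continuous_subtype_val)).norm continuous_const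
  obtain ⟨v, hv, hvD⟩ := hD₀.inter_open_nonempty _ ho ⟨⟨e s, s, hs, rfl⟩, by simpa [e] using hδ0⟩
  have hgv : (v : c → ℂ) ⟨g, hgc⟩ = g (r v) := by rw [← hr v]
  have hv' : ‖g s - g (r v)‖ < δ := by rw [← hgv]; exact hv
  have h1 := hfg s hs
  have h2 := hfg (r v) (hrS v)
  rw [hfD _ ⟨v, hvD, rfl⟩, zero_sub, norm_neg] at h2
  have h3 : ‖f s‖ ≤ ‖f s - g s‖ + ‖g s - g (r v)‖ + ‖g (r v)‖ := by
    calc ‖f s‖ = ‖(f s - g s) + (g s - g (r v)) + g (r v)‖ := by ring_nf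
      _ ≤ _ := norm_add₃_le
  have h4 : δ * (2 * R + 1) = ε := by rw [hδ]; field_simp
  nlinarith

theorem isSeparable_closure_predual (M : VonNeumannAlgebra H)
    [TopologicalSpace.SeparableSpace M.predual] :
    TopologicalSpace.IsSeparable
      (M.predual.topologicalClosure : Set (StrongDual ℂ M.Elt)) := by
  rw [Submodule.topologicalClosure_coe]
  refine TopologicalSpace.IsSeparable.closure ?_
  have := TopologicalSpace.isSeparable_range (continuous_subtype_val (p := (· ∈ M.predual)))
  simpa using this

/-- The bounded case applies to the unit ball of `S`; rescaling gives the rest. -/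
theorem exists_countable_of_separable_predual (M : VonNeumannAlgebra H)
    [TopologicalSpace.SeparableSpace M.predual] (S : Submodule ℂ M.Elt) :
    ∃ D ⊆ (S : Set M.Elt), D.Countable ∧
      ∀ f ∈ M.predual.topologicalClosure, (∀ d ∈ D, f d = 0) → ∀ s ∈ S, f s = 0 := by
  obtain ⟨D, hDS, hDc, hD⟩ := exists_countable_subset_of_isSeparable
    M.isSeparable_closure_predual (S := {s | s ∈ S ∧ ‖s‖ ≤ 1}) (R := 1) fun s hs => hs.2
  refine ⟨D, fun d hd => (hDS hd).1, hDc, fun f hf h0 s hs => ?_⟩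
  rcases eq_or_ne s 0 with rfl | hs0
  · exact map_zero f
  have hn : ‖s‖ ≠ 0 := norm_ne_zero_iff.2 hs0
  have h := hD f hf h0 (((‖s‖⁻¹ : ℝ) : ℂ) • s) ⟨S.smul_mem _ hs, by
    rw [norm_smul, Complex.norm_real, norm_inv, norm_norm, inv_mul_cancel₀ hn]⟩
  rw [map_smul, smul_eq_mul] at h
  exact (mul_eq_zero.1 h).resolve_left (by simpa using hn)

/-! ### From a separable predual to a separable representation. -/

section Reduction

variable {M : VonNeumannAlgebra H} (K : Submodule ℂ H) [CompleteSpace K]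
  (hK : ∀ (x : M.Elt), ∀ v ∈ K, (x : H →L[ℂ] H) v ∈ K)

/-- The restriction of the identity representation of `M` to a closed invariant subspace. -/
def reduction : M.Elt →⋆ₐ[ℂ] (K →L[ℂ] K) where
  toFun x := ((x : H →L[ℂ] H).comp K.subtypeL).codRestrict K fun v => hK x v v.2
  map_one' := rfl
  map_mul' _ _ := rfl
  map_zero' := rfl
  map_add' _ _ := rfl
  commutes' _ := rfl
  map_star' x := by
    rw [ContinuousLinearMap.star_eq_adjoint, ContinuousLinearMap.eq_adjoint_iff]
    intro v w
    exact ContinuousLinearMap.adjoint_inner_left (x : H →L[ℂ] H) (w : H) (v : H)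

theorem coe_reduction_apply (x : M.Elt) (v : K) :
    (reduction K hK x v : H) = (x : H →L[ℂ] H) v := rfl

/-- Square-summable sequences in a subspace, as square-summable sequences in the whole space. -/
def lpSubtype (p : lp (fun _ : ℕ => K) 2) : lp (fun _ : ℕ => H) 2 :=
  ⟨fun n => (p n : H), memℓp_gen ((lp.memℓp p).summable (by norm_num))⟩

/-- Square-summable sequences in `K` are also such sequences in `H`, so they pull back to
functionals `M.seqFun`. -/
theorem isNormalRep_reduction : M.IsNormalRep (reduction K hK) := by
  refine continuous_induced_rng.2 ?_
  refine @continuous_pi _ _ _ M.sigmaWeak _ _ fun p => ?_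
  have h := M.seqFun_mem_predual (lpSubtype K p.1, lpSubtype K p.2)
  change Continuous[M.sigmaWeak, _] _ at h
  refine (congrArg (fun g => Continuous[M.sigmaWeak, inferInstance] g) ?_).mp h
  ext x
  exact M.seqFun_apply _ x

end Reduction

/-- The cyclic subspaces of a von Neumann algebra with separable predual are separable. -/
theorem isSeparable_cyclic (M : VonNeumannAlgebra H) [TopologicalSpace.SeparableSpace M.predual]
    {Z : Set H} (hZ : Z.Countable) :
    TopologicalSpace.IsSeparable ((Submodule.span ℂ (Set.image2
      (fun (x : M.Elt) v => (x : H →L[ℂ] H) v) Set.univ Z)).topologicalClosure : Set H) := by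
  obtain ⟨D, -, hDc, hD⟩ := M.exists_countable_of_separable_predual ⊤
  let L := (Submodule.span ℂ
    (Set.image2 (fun (x : M.Elt) v => (x : H →L[ℂ] H) v) D Z)).topologicalClosure
  have hLs : TopologicalSpace.IsSeparable (L : Set H) :=
    ((hDc.image2 hZ _).isSeparable.span (R := ℂ)).closure
  refine hLs.mono ?_
  refine Submodule.topologicalClosure_minimal _ (Submodule.span_le.2 ?_)
    (Submodule.isClosed_topologicalClosure _)
  rintro _ ⟨x, -, v, hv, rfl⟩
  -- It remains to test `x v` against `w ∈ Lᗮ`: the functional `⟪w, · v⟫` vanishes on `D`, hence on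
  -- all of `M`.
  have hLL : Lᗮᗮ = L := by
    rw [Submodule.orthogonal_orthogonal_eq_closure]
    exact (Submodule.isClosed_topologicalClosure _).submodule_topologicalClosure_eq
  change _ ∈ L
  rw [← hLL, Submodule.mem_orthogonal]
  intro w hw
  refine hD (M.vecFun w v) (Submodule.le_topologicalClosure _ (M.vecFun_mem_predual _ _))
    (fun d hd => ?_) x trivial
  refine Submodule.inner_left_of_mem_orthogonal (K := L) ?_ hw
  exact Submodule.le_topologicalClosure _ (Submodule.subset_span ⟨d, hd, v, hv, rfl⟩)

/-- The right-hand vectors of a countable dense family of vector functionals suffice: if `x` kills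
them, evaluation at `x` vanishes on that family, hence on every vector functional. -/
theorem exists_countable_separating (M : VonNeumannAlgebra H)
    [TopologicalSpace.SeparableSpace M.predual] :
    ∃ Z : Set H, Z.Countable ∧ ∀ x : M.Elt, (∀ v ∈ Z, (x : H →L[ℂ] H) v = 0) → x = 0 := by
  have hs : TopologicalSpace.IsSeparable (Set.range fun p : H × H => M.vecFun p.1 p.2) := by
    refine M.isSeparable_closure_predual.mono ?_
    rintro _ ⟨p, rfl⟩
    exact Submodule.le_topologicalClosure _ (M.vecFun_mem_predual _ _)
  obtain ⟨C, hCr, hCc, hC⟩ := hs.exists_countable_dense_subset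
  choose p hp using fun f : C => hCr f.2
  have := hCc.to_subtype
  refine ⟨Set.range fun f => (p f).2, Set.countable_range _, fun x hx => ?_⟩
  apply Subtype.ext
  ext η
  refine ext_inner_left ℂ fun ξ => ?_
  have hcl : IsClosed {f : StrongDual ℂ M.Elt | f x = 0} :=
    isClosed_eq (ContinuousLinearMap.apply ℂ ℂ x).continuous continuous_const
  have h := closure_minimal (t := {f : StrongDual ℂ M.Elt | f x = 0}) (fun f hf => ?_) hcl
    (hC ⟨(ξ, η), rfl⟩)
  · simpa using h
  · have h1 : M.vecFun (p ⟨f, hf⟩).1 (p ⟨f, hf⟩).2 = f := hp ⟨f, hf⟩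
    change f x = 0
    rw [← h1, vecFun_apply, hx _ ⟨⟨f, hf⟩, rfl⟩, inner_zero_right]

/-- A von Neumann algebra with separable predual has an injective normal representation on a
separable Hilbert space. -/
theorem exists_normalRep_of_separable_predual (M : VonNeumannAlgebra H)
    [TopologicalSpace.SeparableSpace M.predual] :
    ∃ (K : Type u) (_ : NormedAddCommGroup K) (_ : InnerProductSpace ℂ K)
      (_ : CompleteSpace K) (π : M.Elt →⋆ₐ[ℂ] (K →L[ℂ] K)),
      TopologicalSpace.SeparableSpace K ∧ Function.Injective π ∧ M.IsNormalRep π := by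
  obtain ⟨Z, hZc, hZ⟩ := M.exists_countable_separating
  let K := (Submodule.span ℂ
    (Set.image2 (fun (x : M.Elt) v => (x : H →L[ℂ] H) v) Set.univ Z)).topologicalClosure
  have hZK : Z ⊆ K := fun v hv => Submodule.le_topologicalClosure _
    (Submodule.subset_span ⟨1, trivial, v, hv, rfl⟩)
  have hK (x : M.Elt) : ∀ v ∈ K, (x : H →L[ℂ] H) v ∈ K := by
    change K ≤ K.comap ((x : H →L[ℂ] H) : H →ₗ[ℂ] H)
    refine Submodule.topologicalClosure_minimal _ (Submodule.span_le.2 ?_)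
      ((Submodule.isClosed_topologicalClosure _).preimage (x : H →L[ℂ] H).continuous)
    rintro _ ⟨y, -, v, hv, rfl⟩
    exact Submodule.le_topologicalClosure _ (Submodule.subset_span ⟨x * y, trivial, v, hv, rfl⟩)
  have : CompleteSpace K := (Submodule.isClosed_topologicalClosure _).completeSpace_coe
  refine ⟨K, inferInstance, inferInstance, inferInstance, reduction K hK,
    (M.isSeparable_cyclic hZc).separableSpace, ?_, isNormalRep_reduction K hK⟩
  rw [injective_iff_map_eq_zero]
  intro x hx
  refine hZ x fun v hv => ?_
  have := congrArg (fun T : K →L[ℂ] K => (T ⟨v, hZK hv⟩ : H)) hx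
  simpa [coe_reduction_apply] using this

/-! ### From a separable predual to a separable GNS space. -/

/-- A Hilbert space is separable if countably many bounded functionals separate its points. -/
theorem separableSpace_of_countable_functionals {E : Type*} [NormedAddCommGroup E]
    [InnerProductSpace ℂ E] [CompleteSpace E] {C : Set (StrongDual ℂ E)} (hC : C.Countable)
    (h : ∀ v, (∀ f ∈ C, f v = 0) → v = 0) : TopologicalSpace.SeparableSpace E := by
  let L := (Submodule.span ℂ ((InnerProductSpace.toDual ℂ E).symm '' C)).topologicalClosure
  have hL : L = ⊤ := by
    rw [Submodule.topologicalClosure_eq_top_iff, Submodule.eq_bot_iff]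
    intro v hv
    refine h v fun f hf => ?_
    rw [← InnerProductSpace.toDual_symm_apply (𝕜 := ℂ) (x := v) (y := f)]
    exact Submodule.inner_right_of_mem_orthogonal
      (Submodule.subset_span (Set.mem_image_of_mem _ hf)) hv
  have hs : TopologicalSpace.IsSeparable (L : Set E) :=
    ((hC.image _).isSeparable.span (R := ℂ)).closure
  rw [hL] at hs
  exact TopologicalSpace.isSeparable_univ_iff.1 hs

namespace Weight

variable {M : VonNeumannAlgebra H} {φ : M.Weight}

namespace IsSumOf

open PreL2

variable {ι : Type u} {ω : ι → StrongDual ℂ M.Elt} (hω : φ.IsSumOf ω)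

include hω

/-- If the predual is separable, only countably many summands of a semifinite normal weight do
not vanish. -/
theorem countable_ne_zero [TopologicalSpace.SeparableSpace M.predual] (hsf : φ.IsSemifinite) :
    {i | ω i ≠ 0}.Countable := by
  obtain ⟨D, hDS, hDc, hD⟩ := M.exists_countable_of_separable_predual φ.squareFinite
  have hc (d : D) : {i | gnsNorm (ω i) (d : M.Elt) ^ 2 ≠ 0}.Countable :=
    (hω.hasSum_gnsNorm_sq ⟨d, hDS d.2⟩).summable.countable_support
  have := hDc.to_subtype
  -- If `gnsNorm (ω i)` vanishes on `D`, Cauchy–Schwarz against `1` makes `ω i` vanish on `D`, hence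
  -- on `n_φ`, hence everywhere by semifiniteness.
  refine (Set.countable_iUnion hc).mono fun i hi => ?_
  by_contra hcon
  refine hi (ext_of_squareFinite hsf (hω.mem_predual i) fun s hs => ?_)
  refine hD _ (Submodule.le_topologicalClosure _ (hω.mem_predual i)) (fun d hd => ?_) s hs
  have h0 : gnsNorm (ω i) d = 0 := by
    by_contra h
    exact hcon (Set.mem_iUnion.2 ⟨⟨d, hd⟩, pow_ne_zero 2 h⟩)
  have h1 := norm_apply_star_mul_le (hω.nonneg i) 1 d
  rw [h0, mul_zero, star_one, one_mul] at h1
  exact norm_le_zero_iff.1 h1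

/-- The operator `z φ^{1/2} ↦ ω i (· z)`. -/
def rightFun (i : ι) : φ.PreL2 →L[ℂ] StrongDual ℂ M.Elt :=
  LinearMap.mkContinuous
    { toFun := fun z => M.sandwich (star 1) (elt z) (ω i)
      map_add' := fun y z => by ext x; simp [mul_add]
      map_smul' := fun c z => by ext x; simp } (gnsNorm (ω i) 1) fun z =>
    (norm_sandwich_le (hω.nonneg i) 1 (elt z)).trans
      (mul_le_mul_of_nonneg_left (hω.gnsNorm_le i z) (gnsNorm_nonneg _ _))

theorem rightFun_apply (i : ι) (z : φ.PreL2) (y : M.Elt) :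
    hω.rightFun i z y = ω i (y * elt z) := by
  change ω i (star 1 * (y * elt z)) = _
  rw [star_one, one_mul]

theorem rightFun_mem (i : ι) (z : φ.PreL2) :
    hω.rightFun i z ∈ M.predual.topologicalClosure :=
  M.sandwich_mem _ _ (Submodule.le_topologicalClosure _ (hω.mem_predual i))

/-- The continuous extension of `rightFun` to the GNS space. -/
def rightFunL2 (i : ι) : φ.L2 →L[ℂ] StrongDual ℂ M.Elt :=
  (hω.rightFun i).extend (UniformSpace.Completion.toComplL (𝕜 := ℂ) (E := φ.PreL2))

theorem rightFunL2_coe (i : ι) (z : φ.PreL2) :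
    hω.rightFunL2 i (z : φ.L2) = hω.rightFun i z :=
  ContinuousLinearMap.extend_eq _ UniformSpace.Completion.denseRange_coe
    (UniformSpace.Completion.isUniformInducing_coe _) z

theorem rightFunL2_mem (i : ι) (ξ : φ.L2) :
    hω.rightFunL2 i ξ ∈ M.predual.topologicalClosure := by
  induction ξ using UniformSpace.Completion.induction_on with
  | hp => exact (Submodule.isClosed_topologicalClosure _).preimage (hω.rightFunL2 i).continuous
  | ih z =>
    rw [rightFunL2_coe]
    exact hω.rightFun_mem i z

/-- Cauchy–Schwarz for each `ω i`, then over `s`. The bound does not depend on `s`, so it survives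
both the completion and the limit over `s`. -/
theorem norm_sum_rightFunL2_le (s : Finset ι) (x : φ.PreL2) (ξ : φ.L2) :
    ‖∑ i ∈ s, hω.rightFunL2 i ξ (star (elt x))‖ ≤ ‖x‖ * ‖ξ‖ := by
  induction ξ using UniformSpace.Completion.induction_on with
  | hp =>
    refine isClosed_le (continuous_finsetSum _ fun i _ => ?_).norm (by fun_prop)
    exact (ContinuousLinearMap.apply ℂ ℂ (star (elt x))).continuous.comp
      (hω.rightFunL2 i).continuous
  | ih z =>
    simp only [rightFunL2_coe, rightFun_apply, UniformSpace.Completion.norm_coe]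
    have hb (y : φ.PreL2) : √(∑ i ∈ s, gnsNorm (ω i) (elt y) ^ 2) ≤ ‖y‖ :=
      Real.sqrt_le_iff.2 ⟨norm_nonneg _,
        sum_le_hasSum s (fun i _ => sq_nonneg _) (hω.hasSum_gnsNorm_sq y)⟩
    calc ‖∑ i ∈ s, ω i (star (elt x) * elt z)‖
        ≤ ∑ i ∈ s, gnsNorm (ω i) (elt x) * gnsNorm (ω i) (elt z) :=
          norm_sum_le_of_le _ fun i _ => norm_apply_star_mul_le (hω.nonneg i) _ _
      _ ≤ √(∑ i ∈ s, gnsNorm (ω i) (elt x) ^ 2) * √(∑ i ∈ s, gnsNorm (ω i) (elt z) ^ 2) :=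
          Real.sum_mul_le_sqrt_mul_sqrt _ _ _
      _ ≤ ‖x‖ * ‖z‖ := mul_le_mul (hb x) (hb z) (Real.sqrt_nonneg _) (norm_nonneg _)

/-- The maps do not distinguish `z` from `z - ξ`, so `⟪x, z⟫` is bounded by `‖x‖ ‖z - ξ‖`; letting
`z` tend to `ξ` gives `⟪x, ξ⟫ = 0`. -/
theorem eq_zero_of_rightFunL2 {ξ : φ.L2} (h : ∀ i, hω.rightFunL2 i ξ = 0) : ξ = 0 := by
  have h1 (x z : φ.PreL2) : ‖⟪(x : φ.L2), (z : φ.L2)⟫_ℂ‖ ≤ ‖x‖ * ‖(z : φ.L2) - ξ‖ := by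
    rw [UniformSpace.Completion.inner_coe]
    refine le_of_tendsto (hω.hasSum_inner x z).norm (Filter.Eventually.of_forall fun s => ?_)
    refine le_trans (le_of_eq ?_) (hω.norm_sum_rightFunL2_le s x (z - ξ))
    congr 1
    refine Finset.sum_congr rfl fun i _ => ?_
    rw [map_sub, h i, sub_zero, rightFunL2_coe, rightFun_apply]
  have h2 (x : φ.PreL2) (η : φ.L2) : ‖⟪(x : φ.L2), η⟫_ℂ‖ ≤ ‖x‖ * ‖η - ξ‖ := by
    induction η using UniformSpace.Completion.induction_on with
    | hp => exact isClosed_le (by fun_prop) (by fun_prop)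
    | ih z => exact h1 x z
  refine ext_inner_left ℂ fun η => ?_
  rw [inner_zero_right]
  induction η using UniformSpace.Completion.induction_on with
  | hp => exact isClosed_eq (by fun_prop) continuous_const
  | ih x =>
    have h3 := h2 x ξ
    rw [sub_self, norm_zero, mul_zero] at h3
    exact norm_le_zero_iff.1 h3

/-- If the predual is separable, then so is the GNS space of a semifinite normal weight. -/
theorem separableSpace_L2 [TopologicalSpace.SeparableSpace M.predual] (hsf : φ.IsSemifinite) :
    TopologicalSpace.SeparableSpace φ.L2 := by
  obtain ⟨D, -, hDc, hD⟩ := M.exists_countable_of_separable_predual ⊤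
  let A (i : ι) (y : M.Elt) : StrongDual ℂ φ.L2 :=
    (ContinuousLinearMap.apply ℂ ℂ y).comp (hω.rightFunL2 i)
  refine separableSpace_of_countable_functionals
    ((hω.countable_ne_zero hsf).image2 hDc A) fun ξ hξ => ?_
  refine hω.eq_zero_of_rightFunL2 fun i => ?_
  by_cases hi : ω i = 0
  · clear hξ
    induction ξ using UniformSpace.Completion.induction_on with
    | hp => exact isClosed_eq (hω.rightFunL2 i).continuous continuous_const
    | ih z =>
      rw [rightFunL2_coe]
      ext y
      rw [rightFun_apply, hi]
      rfl
  · ext y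
    exact hD _ (hω.rightFunL2_mem i ξ) (fun d hd => hξ _ ⟨i, hi, d, hd, rfl⟩) y trivial

end IsSumOf

end Weight

/-! ### Existence of a normal semifinite faithful weight. -/

omit [CompleteSpace H] in
theorem re_inner_nonneg_of_isPositive {a : H →L[ℂ] H} (ha : a.IsPositive) (ξ : H) :
    0 ≤ (⟪ξ, a ξ⟫_ℂ).re := by
  have := ha.re_inner_nonneg_right ξ
  simpa using this

/-- The weight `a ↦ ∑ ⟪ξ, a ξ⟫`, summed over a set of vectors. -/
def vecWeight (M : VonNeumannAlgebra H) (S : Set H) : M.Weight where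
  toFun a := ∑' ξ : S, ENNReal.ofReal (⟪(ξ : H), (a : H →L[ℂ] H) ξ⟫_ℂ).re
  map_add' a b := by
    rw [← ENNReal.tsum_add]
    refine tsum_congr fun ξ => ?_
    rw [← ENNReal.ofReal_add (re_inner_nonneg_of_isPositive a.2.2 _)
      (re_inner_nonneg_of_isPositive b.2.2 _)]
    simp
  map_smul' c a := by
    rw [RingHom.id_apply, ENNReal.smul_def, smul_eq_mul, ← ENNReal.tsum_mul_left]
    refine tsum_congr fun ξ => ?_
    rw [← ENNReal.ofReal_coe_nnreal, ← ENNReal.ofReal_mul c.coe_nonneg]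
    congr 1
    have h : ((c • a : M.posCone) : H →L[ℂ] H) (ξ : H) = ((c : ℝ) : ℂ) • (a : H →L[ℂ] H) ξ := by
      rw [SetLike.val_smul]
      simp [NNReal.smul_def]
    rw [h, inner_smul_right, Complex.re_ofReal_mul]

theorem vecWeight_sq (M : VonNeumannAlgebra H) (S : Set H) (x : M.Elt) :
    (M.vecWeight S).sq x = ∑' ξ : S, ENNReal.ofReal (‖(x : H →L[ℂ] H) ξ‖ ^ 2) := by
  refine tsum_congr fun ξ => ?_
  congr 1
  change (⟪(ξ : H), (star (x : H →L[ℂ] H)) ((x : H →L[ℂ] H) ξ)⟫_ℂ).re = _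
  rw [ContinuousLinearMap.star_eq_adjoint, ContinuousLinearMap.adjoint_inner_right,
    inner_self_eq_norm_sq_to_K]
  norm_cast

theorem isNormal_vecWeight (M : VonNeumannAlgebra H) (S : Set H) : (M.vecWeight S).IsNormal := by
  refine ⟨S, fun ξ => M.vecFun ξ ξ, fun ξ => M.vecFun_mem_predual _ _, fun ξ x => ?_,
    fun a => rfl⟩
  change 0 ≤ ⟪(ξ : H), (star (x : H →L[ℂ] H)) ((x : H →L[ℂ] H) ξ)⟫_ℂ
  rw [ContinuousLinearMap.star_eq_adjoint, ContinuousLinearMap.adjoint_inner_right,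
    inner_self_eq_norm_sq_to_K]
  rw [← RCLike.ofReal_pow]
  exact Complex.zero_le_real.2 (sq_nonneg _)

/-- The closed subspace generated by a set of vectors under the commutant of `M`. -/
def commutantSpan (M : VonNeumannAlgebra H) (F : Set H) : Submodule ℂ H :=
  (Submodule.span ℂ (Set.image2 (fun (u : H →L[ℂ] H) v => u v)
    (M.commutant : Set (H →L[ℂ] H)) F)).topologicalClosure

instance completeSpace_commutantSpan (M : VonNeumannAlgebra H) (F : Set H) :
    CompleteSpace (M.commutantSpan F) :=
  (Submodule.isClosed_topologicalClosure _).completeSpace_coe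

theorem apply_mem_commutantSpan (M : VonNeumannAlgebra H) {F : Set H} {u : H →L[ℂ] H}
    (hu : u ∈ M.commutant) {v : H} (hv : v ∈ F) : u v ∈ M.commutantSpan F :=
  Submodule.le_topologicalClosure _ (Submodule.subset_span ⟨u, hu, v, hv, rfl⟩)

theorem commutantSpan_mono (M : VonNeumannAlgebra H) : Monotone M.commutantSpan := by
  intro F G h
  exact Submodule.topologicalClosure_mono (Submodule.span_mono (Set.image2_subset_left h))

theorem commutantSpan_le_comap (M : VonNeumannAlgebra H) (F : Set H) {u : H →L[ℂ] H}
    (hu : u ∈ M.commutant) :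
    M.commutantSpan F ≤ (M.commutantSpan F).comap (u : H →ₗ[ℂ] H) := by
  refine Submodule.topologicalClosure_minimal _ (Submodule.span_le.2 ?_)
    ((Submodule.isClosed_topologicalClosure _).preimage u.continuous)
  rintro _ ⟨w, hw, v, hv, rfl⟩
  exact M.apply_mem_commutantSpan (mul_mem hu hw) hv

/-- The projection onto the closed subspace generated by `F` under the commutant belongs
to `M`. -/
theorem starProjection_commutantSpan_mem (M : VonNeumannAlgebra H) (F : Set H) :
    (M.commutantSpan F).starProjection ∈ M.toStarSubalgebra := by
  change (M.commutantSpan F).starProjection ∈ M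
  rw [IsStarProjection.mem_iff isStarProjection_starProjection]
  intro u hu
  rw [Submodule.range_starProjection]
  exact M.commutantSpan_le_comap F hu

/-- Sets of vectors whose orbits under the commutant of `M` are pairwise orthogonal. -/
def HasOrthogonalOrbits (M : VonNeumannAlgebra H) (S : Set H) : Prop :=
  ∀ ξ ∈ S, ∀ η ∈ S, ξ ≠ η → ∀ u ∈ M.commutant, ⟪u ξ, η⟫_ℂ = 0

/-- There is a set of vectors, with pairwise orthogonal orbits under the commutant of `M`, that
is cyclic for the commutant. -/
theorem exists_hasOrthogonalOrbits (M : VonNeumannAlgebra H) :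
    ∃ S : Set H, M.HasOrthogonalOrbits S ∧ M.commutantSpan S = ⊤ := by
  obtain ⟨S, hS⟩ := zorn_subset {S | M.HasOrthogonalOrbits S} fun c hc hchain => by
    refine ⟨⋃₀ c, ?_, fun s hs => Set.subset_sUnion_of_mem hs⟩
    rintro ξ ⟨s, hs, hξ⟩ η ⟨t, ht, hη⟩ hne u hu
    rcases hchain.total hs ht with h | h
    · exact hc ht ξ (h hξ) η hη hne u hu
    · exact hc hs ξ hξ η (h hη) hne u hu
  refine ⟨S, hS.prop, ?_⟩
  rw [← Submodule.orthogonal_eq_bot_iff, Submodule.eq_bot_iff]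
  intro ζ hζ
  have h0 (ξ) (hξ : ξ ∈ S) (u) (hu : u ∈ M.commutant) : ⟪u ξ, ζ⟫_ℂ = 0 :=
    Submodule.inner_right_of_mem_orthogonal (M.apply_mem_commutantSpan hu hξ) hζ
  -- A vector `ζ` orthogonal to the span can be adjoined to `S`; by maximality it is already in `S`,
  -- so it is orthogonal to itself.
  have h1 : M.HasOrthogonalOrbits (insert ζ S) := by
    rintro ξ (rfl | hξ) η (rfl | hη) hne u hu
    · exact absurd rfl hne
    · have h2 := h0 η hη (star u) (star_mem hu)
      rw [ContinuousLinearMap.star_eq_adjoint, ContinuousLinearMap.adjoint_inner_left] at h2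
      exact inner_eq_zero_symm.1 h2
    · exact h0 ξ hξ u hu
    · exact hS.prop ξ hξ η hη hne u hu
  have h3 : ζ ∈ S := hS.le_of_ge h1 (Set.subset_insert _ _) (Set.mem_insert _ _)
  exact inner_self_eq_zero.1 (h0 ζ h3 1 (one_mem M.commutant))

/-- If the weight vanishes at `a = b* b`, then `b`, hence `a`, kills `S`; since `a` commutes with
the commutant, it kills the closed span of the orbits. -/
theorem isFaithful_vecWeight (M : VonNeumannAlgebra H) {S : Set H}
    (hS : M.commutantSpan S = ⊤) : (M.vecWeight S).IsFaithful := by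
  intro a ha
  have h0 (ξ) (hξ : ξ ∈ S) : (a : H →L[ℂ] H) ξ = 0 := by
    obtain ⟨b, hb⟩ := exists_star_mul_self_eq a.2.1 a.2.2
    have hab : M.absSq b = a := Subtype.ext hb
    have h1 : (M.vecWeight S).sq b = 0 := by rw [Weight.sq, hab, ha]
    rw [vecWeight_sq] at h1
    have h2 := ENNReal.ofReal_eq_zero.1 (ENNReal.tsum_eq_zero.1 h1 ⟨ξ, hξ⟩)
    have h3 : (b : H →L[ℂ] H) ξ = 0 := by
      rw [← norm_eq_zero]
      exact pow_eq_zero_iff two_ne_zero |>.1 (le_antisymm h2 (sq_nonneg _))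
    rw [← hb, mul_apply_eq_comp, h3, map_zero]
  apply Subtype.ext
  have h2 : M.commutantSpan S ≤ LinearMap.ker ((a : H →L[ℂ] H) : H →ₗ[ℂ] H) := by
    refine Submodule.topologicalClosure_minimal _ (Submodule.span_le.2 ?_)
      (ContinuousLinearMap.isClosed_ker _)
    rintro _ ⟨u, hu, v, hv, rfl⟩
    have h3 := DFunLike.congr_fun (mem_commutant_iff.1 hu a a.2.1) v
    change (a : H →L[ℂ] H) (u v) = 0
    refine h3.trans ?_
    change u ((a : H →L[ℂ] H) v) = 0
    rw [h0 v hv, map_zero]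
  ext v
  have : v ∈ M.commutantSpan S := hS ▸ Submodule.mem_top
  exact h2 this

/-- Bounded strong convergence implies σ-weak convergence. -/
theorem tendsto_sigmaWeak_of_strong (M : VonNeumannAlgebra H) {α : Type*} {l : Filter α}
    [l.NeBot] {y : α → M.Elt} {x : M.Elt} {R : ℝ} (hR : ∀ a, ‖y a‖ ≤ R)
    (h : ∀ v, Filter.Tendsto (fun a => (y a : H →L[ℂ] H) v) l (𝓝 ((x : H →L[ℂ] H) v))) :
    Filter.Tendsto y l (@nhds _ M.sigmaWeak x) := by
  rw [sigmaWeak_eq_iInf, nhds_iInf, Filter.tendsto_iInf]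
  intro p
  rw [nhds_induced, Filter.tendsto_comap_iff]
  change Filter.Tendsto (fun a => M.seqFun p (y a)) l (𝓝 (M.seqFun p x))
  simp only [seqFun_apply]
  refine tendsto_tsum_of_dominated_convergence
    ((summable_norm_mul_norm p.1 p.2).mul_left R) (fun n => ?_)
    (Filter.Eventually.of_forall fun a n => ?_)
  · exact tendsto_const_nhds.inner (h _)
  · refine (norm_inner_le_norm _ _).trans ?_
    have h1 : ‖(y a : H →L[ℂ] H) (p.2 n)‖ ≤ R * ‖p.2 n‖ :=
      ((y a : H →L[ℂ] H).le_opNorm _).trans (by gcongr; exact hR a)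
    calc _ ≤ ‖p.1 n‖ * (R * ‖p.2 n‖) := by gcongr
      _ = _ := by ring

/-- Approximate `x` by `x e_F`, with `e_F ∈ M` the projection onto the span of the orbits of a
finite `F ⊆ S`. These are bounded and converge strongly to `x`; `e_F` kills the vectors of `S`
outside `F`, so the weight of `(x e_F)* (x e_F)` is a finite sum. -/
theorem isSemifinite_vecWeight (M : VonNeumannAlgebra H) {S : Set H}
    (hS : M.HasOrthogonalOrbits S) (hS' : M.commutantSpan S = ⊤) :
    (M.vecWeight S).IsSemifinite := by
  intro x
  let U (F : Finset S) : Submodule ℂ H := M.commutantSpan (Subtype.val '' (F : Set S))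
  have hU : Monotone U := fun F G h =>
    M.commutantSpan_mono (Set.image_mono (Finset.coe_subset.2 h))
  have : ∀ F, CompleteSpace (U F) := fun F => completeSpace_commutantSpan M _
  have hU' : ⊤ ≤ (⨆ F, U F).topologicalClosure := by
    rw [← hS']
    refine Submodule.topologicalClosure_mono (Submodule.span_le.2 ?_)
    rintro _ ⟨u, hu, v, hv, rfl⟩
    exact (le_iSup U {⟨v, hv⟩}) (M.apply_mem_commutantSpan hu (by simp))
  let e (F : Finset S) : M.Elt := ⟨(U F).starProjection, M.starProjection_commutantSpan_mem _⟩
  refine @mem_closure_of_tendsto _ M.sigmaWeak _ _ _ (fun F => x * e F) _ _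
    (M.tendsto_sigmaWeak_of_strong (l := Filter.atTop) (R := ‖x‖) (fun F => ?_) fun v => ?_)
    (Filter.Eventually.of_forall fun F => ?_)
  · refine (norm_mul_le _ _).trans (mul_le_of_le_one_right (norm_nonneg _) ?_)
    exact (U F).starProjection_norm_le
  · exact ((x : H →L[ℂ] H).continuous.tendsto v).comp
      (Submodule.starProjection_tendsto_self U hU v hU')
  · change (M.vecWeight S).sq (x * e F) < ∞
    rw [vecWeight_sq, tsum_eq_sum (s := F)]
    · exact ENNReal.sum_lt_top.2 fun _ _ => ENNReal.ofReal_lt_top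
    · intro ξ hξ
      have h1 : (ξ : H) ∈ (U F)ᗮ := by
        have h2 : U F ≤ (Submodule.span ℂ {(ξ : H)})ᗮ := by
          refine Submodule.topologicalClosure_minimal _ (Submodule.span_le.2 ?_)
            (Submodule.isClosed_orthogonal _)
          rintro _ ⟨u, hu, _, ⟨η, hη, rfl⟩, rfl⟩
          refine Submodule.mem_orthogonal_singleton_iff_inner_left.2 ?_
          refine hS η η.2 ξ ξ.2 (fun h => hξ ?_) u hu
          rw [← Subtype.ext h]
          exact hη
        exact Submodule.orthogonal_le h2
          (Submodule.le_orthogonal_orthogonal _ (Submodule.mem_span_singleton_self _))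
      have h3 : ((x * e F : M.Elt) : H →L[ℂ] H) ξ = 0 := by
        change (x : H →L[ℂ] H) ((U F).starProjection ξ) = 0
        rw [(U F).starProjection_apply_eq_zero_iff.2 h1, map_zero]
      rw [h3]
      simp

theorem exists_isNSF (M : VonNeumannAlgebra H) : ∃ φ : M.Weight, φ.IsNSF := by
  obtain ⟨S, hS, hS'⟩ := M.exists_hasOrthogonalOrbits
  exact ⟨M.vecWeight S, M.isNormal_vecWeight S, M.isSemifinite_vecWeight hS hS',
    M.isFaithful_vecWeight hS'⟩

end VonNeumannAlgebra

end

theorem lemma1p8 {H : Type u} [NormedAddCommGroup H] [InnerProductSpace ℂ H] [CompleteSpace H]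
    (M : VonNeumannAlgebra H) :
    (∃ φ : M.Weight, φ.IsNSF) ∧
    ∀ φ : M.Weight, φ.IsNSF →
      List.TFAE [
        TopologicalSpace.SeparableSpace M.predual,
        ∃ (K : Type u) (_ : NormedAddCommGroup K) (_ : InnerProductSpace ℂ K)
          (_ : CompleteSpace K) (π : M.Elt →⋆ₐ[ℂ] (K →L[ℂ] K)),
          TopologicalSpace.SeparableSpace K ∧ Function.Injective π ∧ M.IsNormalRep π,
        TopologicalSpace.SeparableSpace φ.L2] := by
  refine ⟨M.exists_isNSF, fun φ hφ => ?_⟩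
  obtain ⟨ι, ω, h1, h2, h3⟩ := hφ.normal
  have hω : φ.IsSumOf ω := ⟨h1, h2, h3⟩
  tfae_have 1 → 2 := fun _ => M.exists_normalRep_of_separable_predual
  tfae_have 2 → 1 := fun ⟨_, _, _, _, π, _, hinj, hπ⟩ =>
    M.separableSpace_predual_of_normalRep π hinj hπ
  tfae_have 1 → 3 := fun _ => hω.separableSpace_L2 hφ.semifinite
  tfae_have 3 → 1 := fun _ => by
    -- Separability need not pass to subspaces in general; second countability does, along the
    -- inducing map into the completion.
    have : TopologicalSpace.SeparableSpace φ.PreL2 := by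
      have := UniformSpace.secondCountable_of_separable φ.L2
      have := (UniformSpace.Completion.isUniformInducing_coe
        φ.PreL2).isInducing.secondCountableTopology
      infer_instance
    exact hω.separableSpace_predual hφ.semifinite hφ.faithful
  tfae_finish
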